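/- Let $n\ge 1$ and let $G$ be a finite connected undirected multigraph without loops (multiple edges allowed) with $n+1$ vertices, labelled $0,\dots,n$. Let $Q(G)=D(G)-A(G)$ be its Laplacian matrix, where $D(G)$ is the diagonal matrix of vertex degrees and $A(G)_{ij}$ is the number of edges joining $i$ and $j$, and let $L_G\subset\mathbb{R}^{n+1}$ be the Laplacian lattice of $G$, i.e. the subgroup generated by the rows of $Q(G)$. Let $A_n=\{x\in\mathbb{Z}^{n+1} : \sum_i x_i=0\}$ be the root lattice, and let $\triangle$ be the regular simplex that is the convex hull of the points $t_0,\dots,t_n$, where $t_i$ has $i$-th coordinate $n$ and all other coordinates $-1$. The covering radius of $L_G$ with respect to $\triangle$ is $$\mathrm{Cov}_\triangle(L_G)=\inf\{R\ge 0 : \text{every } p\in\mathrm{Span}_{\mathbb{R}}(L_G)\text{ lies in } q+R\,\triangle\text{ for some } q\in L_G\},$$ the covolume $\mathrm{Cvol}(L_G)=|A_n/L_G|$ is the order of the quotient group, and the covering density of $L_G$ is $$\theta_\triangle(L_G)=\frac{\mathrm{Cov}_\triangle(L_G)}{\bigl((n+1)\,\mathrm{Cvol}(L_G)\bigr)^{1/n}}.$$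 Then $$\theta_\triangle(L_G)\;\ge\;\frac{n}{2(n+1)}.$$ -/

import Mathlib

open scoped Pointwise

namespace LaplacianLattice

noncomputable section

/-- The homothetic copy `P(p, r) = p + r • P` of a convex body `P`. -/
def homothet {E : Type*} [AddCommGroup E] [Module ℝ E] (P : Set E) (p : E) (r : ℝ) : Set E :=
  p +ᵥ (r • P)

/-- The covering radius of a lattice `L` with respect to `P`: the infimum of the radii `R ≥ 0` such
that every point of the span of `L` lies in `P(q, R)` for some lattice point `q`. -/
def coveringRadius {E : Type*} [AddCommGroup E] [Module ℝ E] (P : Set E) (L : AddSubgroup E) : ℝ :=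
  sInf {R : ℝ | 0 ≤ R ∧
    ∀ p ∈ Submodule.span ℝ (L : Set E), ∃ q ∈ L, p ∈ homothet P q R}

/-- The root lattice `A_n` inside `ℝ^V`, where `V` has `n + 1` elements: the integer vectors whose
coordinates sum to zero. -/
def rootLattice (V : Type*) [Fintype V] : AddSubgroup (V → ℝ) where
  carrier := {x | (∀ i, ∃ z : ℤ, x i = z) ∧ ∑ i, x i = 0}
  zero_mem' := ⟨fun _ => ⟨0, by simp⟩, by simp⟩
  add_mem' := by
    rintro x y ⟨hx, hx0⟩ ⟨hy, hy0⟩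
    refine ⟨fun i => ?_, by simp [Finset.sum_add_distrib, hx0, hy0]⟩
    obtain ⟨a, ha⟩ := hx i
    obtain ⟨b, hb⟩ := hy i
    exact ⟨a + b, by simp [ha, hb]⟩
  neg_mem' := by
    rintro x ⟨hx, hx0⟩
    refine ⟨fun i => ?_, by simp [hx0]⟩
    obtain ⟨a, ha⟩ := hx i
    exact ⟨-a, by simp [ha]⟩

/-- The vertex `t_i` of the regular simplex: `n` at the coordinate `i` and `-1` at every other
coordinate, where `V` has `n + 1` elements. -/
def simplexVertex (V : Type*) [Fintype V] [DecidableEq V] (i : V) : V → ℝ :=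
  fun j => if j = i then (Fintype.card V : ℝ) - 1 else -1

/-- The regular simplex `△`: the convex hull of the points `t_i`. -/
def regularSimplex (V : Type*) [Fintype V] [DecidableEq V] : Set (V → ℝ) :=
  convexHull ℝ (Set.range (simplexVertex V))

/-- The covolume of `L` with respect to `A_n`: the cardinality of the quotient `A_n / L`. -/
def covolume {V : Type*} [Fintype V] (L : AddSubgroup (V → ℝ)) : ℕ :=
  Nat.card (rootLattice V ⧸ L.addSubgroupOf (rootLattice V))

/-- The covering density `θ_P(L) = Cov_P(L) / ((n + 1) * Cvol(L)) ^ (1 / n)` of a sublattice `L` of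
`A_n`, where `V` has `n + 1` elements. -/
def coveringDensity {V : Type*} [Fintype V] (P : Set (V → ℝ)) (L : AddSubgroup (V → ℝ)) : ℝ :=
  coveringRadius P L /
    ((Fintype.card V : ℝ) * (covolume L : ℝ)) ^ (1 / ((Fintype.card V : ℝ) - 1))

/-- A multigraph is connected if any two of its vertices are joined by a path (there is at least one
vertex). -/
def IsConnected {α β : Type*} (G : Graph α β) : Prop :=
  G.vertexSet.Nonempty ∧
    ∀ u ∈ G.vertexSet, ∀ v ∈ G.vertexSet, Relation.ReflTransGen G.Adj u v

/-- The adjacency matrix: the entry at `(u, v)` is the number of edges with ends `u` and `v`. -/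
def adjacencyMatrix {α β : Type*} (G : Graph α β) : Matrix G.vertexSet G.vertexSet ℤ :=
  Matrix.of fun u v => (({e | G.IsLink e u v} : Set β).ncard : ℤ)

/-- The degree of a vertex of a loopless multigraph: the number of edges incident with it. -/
def degree {α β : Type*} (G : Graph α β) (v : G.vertexSet) : ℤ :=
  ((G.incidenceSet (v : α)).ncard : ℤ)

/-- The Laplacian matrix `Q(G) = D(G) - A(G)` of a loopless multigraph. -/
def laplacianMatrix {α β : Type*} [DecidableEq α] (G : Graph α β) :
    Matrix G.vertexSet G.vertexSet ℤ :=
  Matrix.diagonal (degree G) - adjacencyMatrix G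

/-- The Laplacian lattice `L_G`: the subgroup of `ℝ^V` generated by the rows of `Q(G)`. -/
def laplacianLattice {α β : Type*} [DecidableEq α] (G : Graph α β) :
    AddSubgroup (G.vertexSet → ℝ) :=
  AddSubgroup.closure (Set.range fun u : G.vertexSet => fun v => (laplacianMatrix G u v : ℝ))

end

end LaplacianLattice

/-! Let `m` be the number of edges, so the trace of `Q` is `2m`, and let `κ` be the covolume. Two
bounds are combined. Covering radius at least `m / (n + 1)`: an ordering of the vertices gives an
acyclic orientation with indegree vector `ν` of sum `m`, and every `Q f` has `ν v ≤ (Q f) v` at some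
`v` (`exists_indegree_le`). Since `△` is cut out of the sum-zero hyperplane by `x i ≥ -1`, the point
`ν - m / (n + 1)` lies in no smaller dilate about a lattice point. Covolume: `(n + 1) κ ≤ (2m / n) ^
n`, by AM-GM on the nonzero eigenvalues of `Q` (`card_mul_det_grounded_le`), with `κ` computed as
`det (Q + e_r e_rᵀ)` (`covolume_eq`). The quotient of the two bounds is `n / (2 (n + 1))`. -/

namespace LaplacianLattice

open Matrix

/-! ### Determinants, AM-GM and lattice index -/

section Determinant

variable {V R : Type*} [Fintype V] [DecidableEq V] [CommRing R]

/-- Changing the rank one perturbation of a matrix with vanishing row and column sums. -/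
theorem det_add_vecMulVec_of_sums_eq_zero (Q : Matrix V V R) (hr : Q *ᵥ 1 = 0) (hc : 1 ᵥ* Q = 0)
    (a b : V → R) (r : V) :
    (Q + vecMulVec a b).det =
      (∑ i, a i) * (∑ i, b i) * (Q + vecMulVec (Pi.single r 1) (Pi.single r 1)).det := by
  -- The outer factors fix `Q`, whose row and column sums vanish, and turn `e_r e_rᵀ` into `a bᵀ`;
  -- their determinants are the sums of `a` and `b`.
  have key : (1 + vecMulVec (a - Pi.single r 1) 1) *
      (Q + vecMulVec (Pi.single r 1) (Pi.single r 1)) * (1 + vecMulVec 1 (b - Pi.single r 1)) =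
      Q + vecMulVec a b := by
    have h1 : (1 + vecMulVec (a - Pi.single r 1) 1) *
        (Q + vecMulVec (Pi.single r 1) (Pi.single r 1)) = Q + vecMulVec a (Pi.single r 1) := by
      rw [add_mul, one_mul, mul_add, vecMulVec_mul, hc, vecMulVec_mul_vecMulVec]
      ext i j
      simp [vecMulVec_apply]
      ring
    rw [h1, mul_add, mul_one, add_mul, mul_vecMulVec, hr, vecMulVec_mul_vecMulVec]
    ext i j
    simp [vecMulVec_apply]
    ring
  rw [← key, det_mul, det_mul]
  have h2 : (1 + vecMulVec (a - Pi.single r 1) (1 : V → R)).det = ∑ i, a i := by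
    rw [vecMulVec_eq Unit, det_one_add_replicateCol_mul_replicateRow]
    simp [dotProduct, Finset.sum_sub_distrib]
  have h3 : (1 + vecMulVec (1 : V → R) (b - Pi.single r 1)).det = ∑ i, b i := by
    rw [vecMulVec_eq Unit, det_one_add_replicateCol_mul_replicateRow]
    simp [dotProduct, Finset.sum_sub_distrib]
  rw [h2, h3]
  ring

end Determinant

section Inequality

variable {V : Type*} [Fintype V] [DecidableEq V]

/-- The inequality of arithmetic and geometric means for the eigenvalues of a positive semidefinite
matrix. -/
theorem det_le_trace_div_card_pow [Nonempty V] {A : Matrix V V ℝ} (hA : A.PosSemidef) :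
    A.det ≤ (A.trace / Fintype.card V) ^ Fintype.card V := by
  have hc : (0 : ℝ) < Fintype.card V := by exact_mod_cast Fintype.card_pos
  have hdet := hA.isHermitian.det_eq_prod_eigenvalues
  have htr := hA.isHermitian.trace_eq_sum_eigenvalues
  simp only [RCLike.ofReal_real_eq_id, id] at hdet htr
  have hnn := hA.eigenvalues_nonneg
  have h := Real.geom_mean_le_arith_mean_weighted Finset.univ
    (fun _ => (Fintype.card V : ℝ)⁻¹) hA.isHermitian.eigenvalues (fun _ _ => by positivity)
    (by simp [hc.ne']) (fun i _ => hnn i)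
  rw [Real.finsetProd_rpow _ _ (fun i _ => hnn i), ← hdet, ← Finset.mul_sum, ← htr] at h
  have h0 : 0 ≤ A.det := hA.det_nonneg
  calc A.det = (A.det ^ ((Fintype.card V : ℝ)⁻¹)) ^ Fintype.card V :=
        (Real.rpow_inv_natCast_pow h0 Fintype.card_ne_zero).symm
    _ ≤ _ := by
        refine pow_le_pow_left₀ (by positivity) ?_ _
        rwa [div_eq_inv_mul]

end Inequality

section Index

variable {V : Type*} [Fintype V] [DecidableEq V]

/-- The index of the lattice spanned by the columns of a nonsingular integer matrix. -/
theorem index_range_toLin' (N : Matrix V V ℤ) (hN : N.det ≠ 0) :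
    (LinearMap.range N.toLin').toAddSubgroup.index = N.det.natAbs := by
  have hinj : Function.Injective N.toLin' := by
    rw [injective_iff_map_eq_zero]
    intro x hx
    exact eq_zero_of_mulVec_eq_zero hN (by simpa using hx)
  have h := Submodule.natAbs_det_equiv (LinearMap.range N.toLin')
    (LinearEquiv.ofInjective N.toLin' hinj)
  refine h.symm.trans ?_
  rw [← LinearMap.det_toLin' N]
  congr 1

end Index

/-! ### Laplacian matrices: positivity and the determinant bound -/

section Grounded

variable {V : Type*} [DecidableEq V]

/-- The Laplacian matrix with the diagonal entry at `r` increased by one. -/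
def grounded (Q : Matrix V V ℤ) (r : V) : Matrix V V ℤ :=
  Q + vecMulVec (Pi.single r 1) (Pi.single r 1)

theorem map_grounded (Q : Matrix V V ℤ) (r : V) :
    (grounded Q r).map (Int.cast : ℤ → ℝ) =
      Q.map Int.cast + vecMulVec (Pi.single r 1) (Pi.single r 1) := by
  ext i j
  simp [grounded, vecMulVec_apply, Pi.single_apply]

end Grounded

/-- The Laplacian matrices of connected weighted graphs with nonnegative integer weights. -/
structure IsConnectedLaplacian {V : Type*} [Fintype V] (Q : Matrix V V ℤ) : Prop where
  isSymm : Q.IsSymm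
  offDiag_nonpos : ∀ i j, i ≠ j → Q i j ≤ 0
  sum_row : ∀ i, ∑ j, Q i j = 0
  connected : ∀ i j, Relation.ReflTransGen (fun u v => Q u v < 0) i j

namespace IsConnectedLaplacian

variable {V : Type*} [Fintype V] {Q : Matrix V V ℤ}

theorem sum_col (h : IsConnectedLaplacian Q) (j : V) : ∑ i, Q i j = 0 := by
  rw [← h.sum_row j]
  exact Finset.sum_congr rfl fun i _ => h.isSymm.apply j i

theorem sum_row_cast (h : IsConnectedLaplacian Q) (i : V) : ∑ j, (Q i j : ℝ) = 0 := by
  exact_mod_cast h.sum_row i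

theorem sum_col_cast (h : IsConnectedLaplacian Q) (j : V) : ∑ i, (Q i j : ℝ) = 0 := by
  exact_mod_cast h.sum_col j

theorem mulVec_one (h : IsConnectedLaplacian Q) : Q.map (Int.cast : ℤ → ℝ) *ᵥ 1 = 0 := by
  ext i
  simpa [mulVec, dotProduct] using h.sum_row_cast i

theorem one_vecMul (h : IsConnectedLaplacian Q) : 1 ᵥ* Q.map (Int.cast : ℤ → ℝ) = 0 := by
  ext i
  simpa [vecMul, dotProduct] using h.sum_col_cast i

theorem sum_mulVec (h : IsConnectedLaplacian Q) (f : V → ℤ) : ∑ i, (Q *ᵥ f) i = 0 := by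
  simp only [mulVec, dotProduct]
  rw [Finset.sum_comm]
  simp [← Finset.sum_mul, h.sum_col]

theorem sum_mulVec_cast (h : IsConnectedLaplacian Q) (f : V → ℝ) :
    ∑ i, (Q.map (Int.cast : ℤ → ℝ) *ᵥ f) i = 0 := by
  simp only [mulVec, dotProduct, map_apply]
  rw [Finset.sum_comm]
  simp [← Finset.sum_mul, h.sum_col_cast]

/-- The Dirichlet form of a Laplacian matrix. -/
theorem dotProduct_mulVec_eq (h : IsConnectedLaplacian Q) (x : V → ℝ) :
    x ⬝ᵥ (Q.map (Int.cast : ℤ → ℝ) *ᵥ x) = (∑ i, ∑ j, -(Q i j : ℝ) * (x i - x j) ^ 2) / 2 := by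
  have e : ∀ i j, -(Q i j : ℝ) * (x i - x j) ^ 2 =
      2 * (x i * ((Q i j : ℝ) * x j)) - x i ^ 2 * Q i j - x j ^ 2 * Q i j := fun i j => by ring
  simp only [e, Finset.sum_sub_distrib, ← Finset.mul_sum, h.sum_row_cast]
  rw [Finset.sum_comm (f := fun i j => x j ^ 2 * (Q i j : ℝ))]
  simp only [← Finset.mul_sum, h.sum_col_cast]
  simp [dotProduct, mulVec]

theorem dirichlet_term_nonneg (h : IsConnectedLaplacian Q) (x : V → ℝ) (i j : V) :
    0 ≤ -(Q i j : ℝ) * (x i - x j) ^ 2 := by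
  rcases eq_or_ne i j with rfl | hij
  · simp
  · have : (Q i j : ℝ) ≤ 0 := by exact_mod_cast h.offDiag_nonpos i j hij
    exact mul_nonneg (by linarith) (sq_nonneg _)

theorem posSemidef (h : IsConnectedLaplacian Q) : (Q.map (Int.cast : ℤ → ℝ)).PosSemidef := by
  refine PosSemidef.of_dotProduct_mulVec_nonneg ?_ fun x => ?_
  · ext i j
    simp [h.isSymm.apply i j]
  · rw [star_trivial, h.dotProduct_mulVec_eq]
    have := Finset.sum_nonneg fun i (_ : i ∈ Finset.univ) =>
      Finset.sum_nonneg fun j (_ : j ∈ Finset.univ) => h.dirichlet_term_nonneg x i j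
    linarith

/-- All terms of the Dirichlet form vanish, so `x` agrees across each edge, and connectedness
propagates this. -/
theorem eq_of_dotProduct_mulVec_eq_zero (h : IsConnectedLaplacian Q) {x : V → ℝ}
    (hx : x ⬝ᵥ (Q.map (Int.cast : ℤ → ℝ) *ᵥ x) = 0) (i j : V) : x i = x j := by
  have hsum : ∑ i, ∑ j, -(Q i j : ℝ) * (x i - x j) ^ 2 = 0 := by
    rw [h.dotProduct_mulVec_eq] at hx
    linarith
  rw [Finset.sum_eq_zero_iff_of_nonneg
    fun i _ => Finset.sum_nonneg fun j _ => h.dirichlet_term_nonneg x i j] at hsum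
  have step : ∀ u v, Q u v < 0 → x u = x v := fun u v huv => by
    have h1 := (Finset.sum_eq_zero_iff_of_nonneg
      fun j _ => h.dirichlet_term_nonneg x u j).1 (hsum u (Finset.mem_univ u)) v (Finset.mem_univ v)
    have h2 : (Q u v : ℝ) ≠ 0 := by exact_mod_cast huv.ne
    have h3 : x u - x v = 0 := by simpa [h2] using h1
    linarith
  induction h.connected i j with
  | refl => rfl
  | tail _ hv ih => rw [ih, step _ _ hv]

variable [DecidableEq V]

theorem grounded_mulVec (r : V) (f : V → ℤ) :
    grounded Q r *ᵥ f = Q *ᵥ f + Pi.single r (f r) := by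
  rw [grounded, add_mulVec, vecMulVec_mulVec]
  ext i
  simp [Pi.single_apply]

theorem map_grounded_mulVec (r : V) (f : V → ℝ) :
    (grounded Q r).map (Int.cast : ℤ → ℝ) *ᵥ f = Q.map Int.cast *ᵥ f + Pi.single r (f r) := by
  rw [map_grounded, add_mulVec, vecMulVec_mulVec]
  ext i
  simp [Pi.single_apply]

theorem cast_det_grounded (r : V) :
    ((grounded Q r).det : ℝ) = ((grounded Q r).map (Int.cast : ℤ → ℝ)).det :=
  (Int.castRingHom ℝ).map_det _

theorem posSemidef_grounded (h : IsConnectedLaplacian Q) (r : V) :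
    ((grounded Q r).map (Int.cast : ℤ → ℝ)).PosSemidef := by
  rw [map_grounded]
  refine h.posSemidef.add ?_
  simpa using posSemidef_vecMulVec_self_star (Pi.single r (1 : ℝ))

/-- A kernel vector satisfies `xᵀ Q x + (x r)² = 0`, so it is constant and zero at `r`. -/
theorem det_map_grounded_ne_zero (h : IsConnectedLaplacian Q) (r : V) :
    ((grounded Q r).map (Int.cast : ℤ → ℝ)).det ≠ 0 := by
  intro hdet
  obtain ⟨x, hx0, hx⟩ := exists_mulVec_eq_zero_iff.2 hdet
  rw [map_grounded_mulVec] at hx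
  have h1 := congrArg (x ⬝ᵥ ·) hx
  simp only [dotProduct_add, dotProduct_single, dotProduct_zero] at h1
  have h2 : 0 ≤ x ⬝ᵥ (Q.map (Int.cast : ℤ → ℝ) *ᵥ x) := by
    simpa using h.posSemidef.dotProduct_mulVec_nonneg x
  have h3 : x r = 0 := by nlinarith [mul_self_nonneg (x r)]
  rw [h3, mul_zero, add_zero] at h1
  exact hx0 (funext fun i => (h.eq_of_dotProduct_mulVec_eq_zero h1 i r).trans h3)

theorem det_grounded_pos (h : IsConnectedLaplacian Q) (r : V) : 0 < (grounded Q r).det := by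
  have h1 : (0 : ℝ) < (grounded Q r).det := by
    rw [cast_det_grounded]
    exact (h.posSemidef_grounded r).det_nonneg.lt_of_ne' (h.det_map_grounded_ne_zero r)
  exact_mod_cast h1

/-- A real vector with vanishing coordinate sum is in the range of the Laplacian matrix. -/
theorem exists_mulVec_eq (h : IsConnectedLaplacian Q) (r : V) {p : V → ℝ} (hp : ∑ i, p i = 0) :
    ∃ x, Q.map (Int.cast : ℤ → ℝ) *ᵥ x = p := by
  have hunit : IsUnit ((grounded Q r).map (Int.cast : ℤ → ℝ)).det :=
    (h.det_map_grounded_ne_zero r).isUnit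
  refine ⟨((grounded Q r).map (Int.cast : ℤ → ℝ))⁻¹ *ᵥ p, ?_⟩
  set x := ((grounded Q r).map (Int.cast : ℤ → ℝ))⁻¹ *ᵥ p with hx
  have h1 : (grounded Q r).map (Int.cast : ℤ → ℝ) *ᵥ x = p := by
    rw [hx, mulVec_mulVec, mul_nonsing_inv _ hunit, one_mulVec]
  rw [map_grounded_mulVec] at h1
  -- Summing coordinates kills both `Q x` and `p`, leaving only `x r`.
  have h2 : x r = 0 := by
    have := congrArg (fun y : V → ℝ => ∑ i, y i) h1
    simpa [Finset.sum_add_distrib, h.sum_mulVec_cast, hp] using this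
  rwa [h2, Pi.single_zero, add_zero] at h1

/-- The bound for the number of spanning trees in terms of the sum of the degrees. -/
theorem card_mul_det_grounded_le (h : IsConnectedLaplacian Q) (r : V) {n : ℕ} (hn : 1 ≤ n)
    (hcard : Fintype.card V = n + 1) :
    ((n : ℝ) + 1) * (grounded Q r).det ≤ ((Q.trace : ℝ) / n) ^ n := by
  have : Nonempty V := ⟨r⟩
  have hn0 : (0 : ℝ) < n := by exact_mod_cast hn
  -- Adding `s²` to every entry moves the eigenvalue of the all-ones vector from `0` to `s² (n + 1)`
  -- and keeps the others.
  have key : ∀ s : ℝ, s ^ 2 * ((n : ℝ) + 1) ^ 2 * (grounded Q r).det ≤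
      (((Q.trace : ℝ) + s ^ 2 * (n + 1)) / (n + 1)) ^ (n + 1) := by
    intro s
    have hpsd : (Q.map (Int.cast : ℤ → ℝ) + vecMulVec (fun _ => s) (fun _ => s)).PosSemidef := by
      refine h.posSemidef.add ?_
      simpa [Pi.star_def] using posSemidef_vecMulVec_self_star (fun _ : V => s)
    have h1 := det_le_trace_div_card_pow hpsd
    rw [det_add_vecMulVec_of_sums_eq_zero _ h.mulVec_one h.one_vecMul _ _ r, ← map_grounded,
      trace_add, trace_vecMulVec] at h1
    have h2 : (Q.map (Int.cast : ℤ → ℝ)).trace = (Q.trace : ℝ) := by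
      simp [trace]
    rw [h2] at h1
    simp only [Finset.sum_const, Finset.card_univ, hcard, nsmul_eq_mul, dotProduct] at h1
    rw [← cast_det_grounded, Nat.cast_succ] at h1
    convert h1 using 1
    · ring
    · congr 2
      ring
  have hdet : (1 : ℝ) ≤ (grounded Q r).det := by exact_mod_cast h.det_grounded_pos r
  have htr0 : (0 : ℝ) ≤ Q.trace := by
    have h1 := h.posSemidef.trace_nonneg
    simpa [trace] using h1
  have htr : (0 : ℝ) < Q.trace := by
    -- With zero trace, `s = 1` would give `(n + 1)² det ≤ 1`.
    refine htr0.lt_of_ne fun h0 => ?_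
    have h1 := key 1
    rw [← h0] at h1
    have h2 : ((0 + 1 ^ 2 * ((n : ℝ) + 1)) / (n + 1)) = 1 := by field_simp; ring
    rw [h2, one_pow, one_pow] at h1
    have h3 : (1 : ℝ) < (n + 1) ^ 2 := by nlinarith
    nlinarith
  have hm : (0 : ℝ) < Q.trace / n := by positivity
  -- This `s` makes the new eigenvalue equal to the mean `trace / n` of the other `n`, so one factor
  -- cancels.
  have h1 := key (Real.sqrt ((Q.trace : ℝ) / n / (n + 1)))
  rw [Real.sq_sqrt (by positivity)] at h1
  have h2 : ((Q.trace : ℝ) + Q.trace / n / (n + 1) * (n + 1)) / (n + 1) = Q.trace / n := by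
    field_simp
  have h3 : (Q.trace : ℝ) / n / (n + 1) * (n + 1) ^ 2 * (grounded Q r).det =
      (((n : ℝ) + 1) * (grounded Q r).det) * (Q.trace / n) := by
    field_simp
  rw [h2, h3, pow_succ] at h1
  exact le_of_mul_le_mul_right h1 hm

end IsConnectedLaplacian

/-! ### The simplex by inequalities -/

section Simplex

variable {V : Type*} [Fintype V] [DecidableEq V]

theorem neg_one_le_of_mem_regularSimplex {x : V → ℝ} (hx : x ∈ regularSimplex V) (i : V) :
    -1 ≤ x i := by
  have hconv : Convex ℝ {y : V → ℝ | -1 ≤ y i} :=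
    convex_halfSpace_ge (LinearMap.proj (R := ℝ) (φ := fun _ : V => ℝ) i).isLinear (-1)
  refine convexHull_min ?_ hconv hx
  rintro _ ⟨j, rfl⟩
  have hc : (1 : ℝ) ≤ Fintype.card V := by
    exact_mod_cast Fintype.card_pos_iff.2 ⟨i⟩
  simp only [Set.mem_ofPred_eq, simplexVertex]
  split_ifs <;> linarith

/-- The barycentric coordinates of `x` are `(x i + 1) / (n + 1)`. -/
theorem mem_regularSimplex [Nonempty V] {x : V → ℝ} (hsum : ∑ i, x i = 0) (hx : ∀ i, -1 ≤ x i) :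
    x ∈ regularSimplex V := by
  have hc : (0 : ℝ) < Fintype.card V := by exact_mod_cast Fintype.card_pos
  have hw : ∑ i, (x i + 1) / (Fintype.card V : ℝ) = 1 := by
    rw [← Finset.sum_div, Finset.sum_add_distrib, hsum]
    simp [hc.ne']
  have h := (convex_convexHull ℝ (Set.range (simplexVertex V))).sum_mem
    (t := Finset.univ) (w := fun i => (x i + 1) / (Fintype.card V : ℝ)) (z := simplexVertex V)
    (fun i _ => div_nonneg (by linarith [hx i]) hc.le) hw
    (fun i _ => subset_convexHull ℝ _ ⟨i, rfl⟩)
  have hx' : x = ∑ i, ((x i + 1) / (Fintype.card V : ℝ)) • simplexVertex V i := by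
    ext j
    have e : ∀ i, (x i + 1) / (Fintype.card V : ℝ) * simplexVertex V i j =
        (if j = i then x i + 1 else 0) - (x i + 1) / (Fintype.card V : ℝ) := fun i => by
      simp only [simplexVertex]
      split_ifs
      · field_simp
      · ring
    simp only [Finset.sum_apply, Pi.smul_apply, smul_eq_mul, e, Finset.sum_sub_distrib, hw]
    simp
  rw [hx']
  exact h

theorem neg_le_of_mem_homothet {p q : V → ℝ} {R : ℝ} (hR : 0 ≤ R)
    (h : p ∈ homothet (regularSimplex V) q R) (i : V) : q i - R ≤ p i := by
  obtain ⟨_, ⟨x, hx, rfl⟩, rfl⟩ := h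
  have := mul_le_mul_of_nonneg_left (neg_one_le_of_mem_regularSimplex hx i) hR
  simp only [vadd_eq_add, Pi.add_apply, Pi.smul_apply, smul_eq_mul]
  linarith

theorem mem_homothet [Nonempty V] {p q : V → ℝ} {R : ℝ} (hR : 0 < R)
    (hsum : ∑ i, (p i - q i) = 0) (h : ∀ i, q i - R ≤ p i) :
    p ∈ homothet (regularSimplex V) q R := by
  refine ⟨p - q, ⟨R⁻¹ • (p - q), mem_regularSimplex ?_ fun i => ?_, ?_⟩, ?_⟩
  · simp [← Finset.mul_sum, hsum]
  · simp only [Pi.smul_apply, Pi.sub_apply, smul_eq_mul]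
    rw [← div_eq_inv_mul, le_div_iff₀ hR]
    linarith [h i]
  · simp [smul_smul, hR.ne']
  · simp

end Simplex

/-! ### The row lattice and its covering radius -/

/-- The subgroup of `ℝ^V` generated by the rows of an integer matrix. -/
def rowLattice {V : Type*} (Q : Matrix V V ℤ) : AddSubgroup (V → ℝ) :=
  AddSubgroup.closure (Set.range fun u : V => fun v => (Q u v : ℝ))

theorem mem_rowLattice {V : Type*} [Fintype V] {Q : Matrix V V ℤ} (hQ : Q.IsSymm) {q : V → ℝ} :
    q ∈ rowLattice Q ↔ ∃ f : V → ℤ, q = fun v => ((Q *ᵥ f) v : ℝ) := by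
  constructor
  · intro hq
    induction hq using AddSubgroup.closure_induction with
    | mem x hx =>
      classical
      obtain ⟨u, rfl⟩ := hx
      refine ⟨Pi.single u 1, ?_⟩
      ext v
      simp [hQ.apply u v]
    | zero => exact ⟨0, by ext; simp⟩
    | add x y _ _ hx hy =>
      obtain ⟨f, rfl⟩ := hx
      obtain ⟨g, rfl⟩ := hy
      exact ⟨f + g, by ext; simp [mulVec_add]⟩
    | neg x _ hx =>
      obtain ⟨f, rfl⟩ := hx
      exact ⟨-f, by ext; simp [mulVec_neg]⟩
  · rintro ⟨f, rfl⟩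
    have : (fun v => ((Q *ᵥ f) v : ℝ)) = ∑ u, f u • fun v => (Q u v : ℝ) := by
      ext v
      simp only [mulVec, dotProduct, Int.cast_sum, Int.cast_mul, Finset.sum_apply, zsmul_eq_mul]
      exact Finset.sum_congr rfl fun u _ => by rw [hQ.apply u v, mul_comm]; rfl
    rw [this]
    exact sum_mem fun u _ => zsmul_mem (AddSubgroup.subset_closure (Set.mem_range_self u)) _

namespace IsConnectedLaplacian

variable {V : Type*} [Fintype V] {Q : Matrix V V ℤ}

theorem mem_span_rowLattice (h : IsConnectedLaplacian Q) (r : V) {p : V → ℝ}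
    (hp : ∑ i, p i = 0) : p ∈ Submodule.span ℝ (rowLattice Q : Set (V → ℝ)) := by
  classical
  obtain ⟨x, rfl⟩ := h.exists_mulVec_eq r hp
  have : Q.map (Int.cast : ℤ → ℝ) *ᵥ x = ∑ u, x u • fun v => (Q u v : ℝ) := by
    ext v
    simp only [mulVec, dotProduct, map_apply, Finset.sum_apply, Pi.smul_apply, smul_eq_mul]
    exact Finset.sum_congr rfl fun u _ => by rw [h.isSymm.apply u v, mul_comm]
  rw [this]
  exact Submodule.sum_mem _ fun u _ => Submodule.smul_mem _ _
    (Submodule.subset_span (AddSubgroup.subset_closure ⟨u, rfl⟩))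

theorem sum_eq_zero_of_mem_span (h : IsConnectedLaplacian Q) {p : V → ℝ}
    (hp : p ∈ Submodule.span ℝ (rowLattice Q : Set (V → ℝ))) : ∑ i, p i = 0 := by
  induction hp using Submodule.span_induction with
  | mem x hx =>
    obtain ⟨f, rfl⟩ := (mem_rowLattice h.isSymm).1 hx
    simpa using congrArg (Int.cast : ℤ → ℝ) (h.sum_mulVec f)
  | zero => simp
  | add x y _ _ hx hy => simp [Finset.sum_add_distrib, hx, hy]
  | smul a x _ hx => simp [← Finset.mul_sum, hx]

/-- The dilations of the simplex by some radius, centred at the lattice points, cover the span. -/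
theorem exists_covering (h : IsConnectedLaplacian Q) [DecidableEq V] [Nonempty V] :
    ∃ R : ℝ, 0 ≤ R ∧ ∀ p ∈ Submodule.span ℝ (rowLattice Q : Set (V → ℝ)),
      ∃ q ∈ rowLattice Q, p ∈ homothet (regularSimplex V) q R := by
  -- Rounding `x` down moves each coordinate of `Q x` by at most an absolute row sum; the `1` keeps
  -- the radius positive.
  have hR : (0 : ℝ) < 1 + ∑ v, ∑ u, |(Q v u : ℝ)| := by positivity
  refine ⟨_, hR.le, fun p hp => ?_⟩
  have hp0 := h.sum_eq_zero_of_mem_span hp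
  obtain ⟨x, rfl⟩ := h.exists_mulVec_eq (Classical.arbitrary V) hp0
  refine ⟨_, (mem_rowLattice h.isSymm).2 ⟨fun u => ⌊x u⌋, rfl⟩, mem_homothet hR ?_ fun i => ?_⟩
  · rw [Finset.sum_sub_distrib, hp0, zero_sub, neg_eq_zero]
    exact_mod_cast h.sum_mulVec _
  · have h1 : (Q.map (Int.cast : ℤ → ℝ) *ᵥ x) i - ((Q *ᵥ fun u => ⌊x u⌋) i : ℝ) =
        ∑ u, (Q i u : ℝ) * Int.fract (x u) := by
      simp only [mulVec, dotProduct, map_apply, Int.cast_sum, Int.cast_mul]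
      rw [← Finset.sum_sub_distrib]
      exact Finset.sum_congr rfl fun u _ => by rw [Int.fract]; ring
    have h2 : -∑ u, |(Q i u : ℝ)| ≤ ∑ u, (Q i u : ℝ) * Int.fract (x u) := by
      rw [← Finset.sum_neg_distrib]
      refine Finset.sum_le_sum fun u _ => ?_
      have h3 : |(Q i u : ℝ) * Int.fract (x u)| ≤ |(Q i u : ℝ)| := by
        rw [abs_mul, abs_of_nonneg (Int.fract_nonneg (x u))]
        exact mul_le_of_le_one_right (abs_nonneg _) (Int.fract_lt_one _).le
      linarith [neg_abs_le ((Q i u : ℝ) * Int.fract (x u))]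
    have h3 : ∑ u, |(Q i u : ℝ)| ≤ ∑ v, ∑ u, |(Q v u : ℝ)| :=
      Finset.single_le_sum (f := fun v => ∑ u, |(Q v u : ℝ)|) (fun v _ => by positivity)
        (Finset.mem_univ i)
    linarith

/-- The total weight of the edges from `v` to vertices preceding it in the ordering `e`. -/
def indegree (Q : Matrix V V ℤ) (e : V → ℕ) (v : V) : ℤ :=
  ∑ w, if e w < e v then -Q v w else 0

theorem two_mul_sum_indegree (h : IsConnectedLaplacian Q) {e : V → ℕ} (he : e.Injective) :
    2 * ∑ v, indegree Q e v = Q.trace := by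
  classical
  have h1 : ∑ v, indegree Q e v = ∑ v, ∑ w, if e v < e w then -Q v w else 0 := by
    simp only [indegree]
    rw [Finset.sum_comm]
    exact Finset.sum_congr rfl fun v _ => Finset.sum_congr rfl fun w _ => by
      rw [h.isSymm.apply]
  rw [two_mul]
  nth_rw 2 [h1]
  simp only [indegree, ← Finset.sum_add_distrib]
  -- Each `w ≠ v` is counted exactly once, before or after `v`, so the row sum leaves `Q v v`.
  refine Finset.sum_congr rfl fun v _ => ?_
  have h2 : ∀ w, ((if e w < e v then -Q v w else 0) + if e v < e w then -Q v w else 0) =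
      (if v = w then Q v w else 0) - Q v w := fun w => by
    rcases lt_trichotomy (e w) (e v) with hlt | heq | hlt
    · have : v ≠ w := fun hvw => by simp [hvw] at hlt
      simp [hlt, hlt.not_gt, this]
    · simp [he heq]
    · have : v ≠ w := fun hvw => by simp [hvw] at hlt
      simp [hlt, hlt.not_gt, this]
  simp [h2, Finset.sum_sub_distrib, h.sum_row v]

/-- No principal divisor is strictly smaller at every vertex than the indegree divisor of an acyclic
orientation. -/
theorem exists_indegree_le (h : IsConnectedLaplacian Q) [Nonempty V] (e : V → ℕ)
    (f : V → ℤ) : ∃ v, indegree Q e v ≤ (Q *ᵥ f) v := by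
  -- Take `v` maximising `f`, with least `e` among ties. Vertices preceding `v` then have `f w ≤ f v
  -- - 1`, and all others `f w ≤ f v`.
  obtain ⟨v, -, hv⟩ := Finset.exists_max_image Finset.univ
    (fun v => toLex (f v, OrderDual.toDual (e v))) Finset.univ_nonempty
  refine ⟨v, ?_⟩
  have h1 : (Q *ᵥ f) v = ∑ w, -Q v w * (f v - f w) := by
    have h2 : ∀ w, -Q v w * (f v - f w) = Q v w * f w - Q v w * f v := fun w => by ring
    simp only [h2, Finset.sum_sub_distrib, ← Finset.sum_mul, h.sum_row v]
    simp [mulVec, dotProduct]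
  rw [h1]
  refine Finset.sum_le_sum fun w _ => ?_
  rcases eq_or_ne v w with rfl | hvw
  · simp
  have hq := h.offDiag_nonpos v w hvw
  have hw := hv w (Finset.mem_univ w)
  rw [Prod.Lex.toLex_le_toLex] at hw
  simp only [OrderDual.toDual_le_toDual] at hw
  split_ifs with hlt
  · have : f w < f v := by
      rcases hw with hw | ⟨-, hw⟩
      · exact hw
      · omega
    nlinarith
  · have : f w ≤ f v := by
      rcases hw with hw | ⟨hw, -⟩
      · exact hw.le
      · exact hw.le
    nlinarith

/-- The covering radius of a Laplacian lattice is at least the number of edges divided by the number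
of vertices. -/
theorem trace_div_le_coveringRadius (h : IsConnectedLaplacian Q) [DecidableEq V] [Nonempty V] :
    (Q.trace : ℝ) / (2 * Fintype.card V) ≤
      coveringRadius (regularSimplex V) (rowLattice Q) := by
  have hc : (0 : ℝ) < Fintype.card V := by exact_mod_cast Fintype.card_pos
  refine le_csInf h.exists_covering ?_
  rintro R ⟨hR, hcov⟩
  let e : V → ℕ := fun v => Fintype.equivFin V v
  have he : e.Injective := Fin.val_injective.comp (Fintype.equivFin V).injective
  have htr : 2 * ∑ v, (indegree Q e v : ℝ) = Q.trace := by
    exact_mod_cast h.two_mul_sum_indegree he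
  -- The test point is the indegree vector shifted to sum zero by its mean `m / (n + 1)`.
  have hsum : ∑ v, ((indegree Q e v : ℝ) - (Q.trace : ℝ) / (2 * Fintype.card V)) = 0 := by
    rw [Finset.sum_sub_distrib, ← htr]
    simp
    field_simp
    ring
  obtain ⟨q, hq, hpq⟩ := hcov _ (h.mem_span_rowLattice (Classical.arbitrary V) hsum)
  obtain ⟨f, rfl⟩ := (mem_rowLattice h.isSymm).1 hq
  obtain ⟨v, hv⟩ := h.exists_indegree_le e f
  have h1 := neg_le_of_mem_homothet hR hpq v
  have h2 : (indegree Q e v : ℝ) ≤ ((Q *ᵥ f) v : ℝ) := by exact_mod_cast hv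
  linarith

end IsConnectedLaplacian

/-! ### The covolume as a determinant, and the density bound -/

section Projection

variable {V : Type*} [Fintype V] [DecidableEq V]

/-- The projection of the integer lattice onto the root lattice along the coordinate axis of `r`. -/
def toRootLattice (r : V) : (V → ℤ) →+ rootLattice V where
  toFun x := ⟨fun v => ((x - Pi.single r (∑ i, x i) : V → ℤ) v : ℝ),
    fun v => ⟨(x - Pi.single r (∑ i, x i) : V → ℤ) v, rfl⟩, by
      rw [← Int.cast_sum]
      simp [Finset.sum_sub_distrib]⟩
  map_zero' := by
    ext
    simp
  map_add' x y := by
    ext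
    simp [Finset.sum_add_distrib, Pi.single_add]
    ring

theorem coe_toRootLattice (r : V) (x : V → ℤ) :
    (toRootLattice r x : V → ℝ) = fun v => ((x - Pi.single r (∑ i, x i) : V → ℤ) v : ℝ) :=
  rfl

theorem toRootLattice_surjective (r : V) : Function.Surjective (toRootLattice r) := by
  rintro ⟨y, hy, hy0⟩
  have hy' := hy
  choose z hz using hy'
  have hz0 : ∑ i, z i = 0 := by
    simp only [hz] at hy0
    exact_mod_cast hy0
  refine ⟨z, Subtype.ext ?_⟩
  rw [coe_toRootLattice, hz0]
  ext v
  simp [hz]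

end Projection

namespace IsConnectedLaplacian

variable {V : Type*} [Fintype V] [DecidableEq V] {Q : Matrix V V ℤ}

/-- `grounded Q r *ᵥ f` is `Q f + f r • e_r`, with coordinate sum `f r`, so the projection returns
`Q f`. -/
theorem comap_toRootLattice (h : IsConnectedLaplacian Q) (r : V) :
    ((rowLattice Q).addSubgroupOf (rootLattice V)).comap (toRootLattice r) =
      (LinearMap.range (grounded Q r).toLin').toAddSubgroup := by
  ext x
  rw [AddSubgroup.mem_comap, AddSubgroup.mem_addSubgroupOf, mem_rowLattice h.isSymm,
    coe_toRootLattice, Submodule.mem_toAddSubgroup, LinearMap.mem_range]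
  constructor
  · rintro ⟨f, hf⟩
    have hf' : x - Pi.single r (∑ i, x i) = Q *ᵥ f := by
      ext v
      exact_mod_cast congrFun hf v
    -- The constant shift leaves `Q f` unchanged and makes the value at `r` the required coordinate
    -- sum.
    refine ⟨f + (fun _ => ∑ i, x i - f r), ?_⟩
    have h0 : Q *ᵥ (fun _ => ∑ i, x i - f r) = 0 := by
      ext i
      simp [mulVec, dotProduct, ← Finset.sum_mul, h.sum_row]
    rw [toLin'_apply, grounded_mulVec, mulVec_add, h0, ← hf']
    simp
  · rintro ⟨f, rfl⟩
    refine ⟨f, ?_⟩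
    rw [toLin'_apply, grounded_mulVec]
    simp [Finset.sum_add_distrib, h.sum_mulVec]

/-- The covolume of a Laplacian lattice is a principal minor of the Laplacian matrix. -/
theorem covolume_eq (h : IsConnectedLaplacian Q) (r : V) :
    (covolume (rowLattice Q) : ℤ) = (grounded Q r).det := by
  have h1 := AddSubgroup.index_comap_of_surjective
    ((rowLattice Q).addSubgroupOf (rootLattice V)) (toRootLattice_surjective r)
  rw [h.comap_toRootLattice, index_range_toLin' _ (h.det_grounded_pos r).ne'] at h1
  have h2 : covolume (rowLattice Q) = (grounded Q r).det.natAbs := h1.symm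
  rw [h2, Int.natAbs_of_nonneg (h.det_grounded_pos r).le]

theorem le_coveringDensity (h : IsConnectedLaplacian Q) {n : ℕ} (hn : 1 ≤ n)
    (hcard : Fintype.card V = n + 1) :
    (n : ℝ) / (2 * ((n : ℝ) + 1)) ≤ coveringDensity (regularSimplex V) (rowLattice Q) := by
  have : Nonempty V := Fintype.card_pos_iff.1 (by omega)
  let r : V := Classical.arbitrary V
  have hn0 : (0 : ℝ) < n := by exact_mod_cast hn
  have hcov := h.trace_div_le_coveringRadius
  have hdet : (0 : ℝ) < (grounded Q r).det := by exact_mod_cast h.det_grounded_pos r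
  have htr : (0 : ℝ) ≤ Q.trace := by
    have h1 := h.posSemidef.trace_nonneg
    simpa [trace] using h1
  have hcv : (covolume (rowLattice Q) : ℝ) = (grounded Q r).det := by
    exact_mod_cast congrArg (Int.cast : ℤ → ℝ) (h.covolume_eq r)
  have hc : (Fintype.card V : ℝ) = n + 1 := by rw [hcard]; push_cast; rfl
  rw [coveringDensity, hcv, hc, add_sub_cancel_right]
  rw [hc] at hcov
  have hpos : (0 : ℝ) < ((n + 1) * (grounded Q r).det : ℝ) := by positivity
  have hroot : ((n + 1) * (grounded Q r).det : ℝ) ^ (1 / (n : ℝ)) ≤ Q.trace / n := by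
    calc ((n + 1) * (grounded Q r).det : ℝ) ^ (1 / (n : ℝ))
        ≤ (((Q.trace : ℝ) / n) ^ n) ^ (1 / (n : ℝ)) :=
          Real.rpow_le_rpow hpos.le (h.card_mul_det_grounded_le r hn hcard) (by positivity)
      _ = Q.trace / n := by
          rw [one_div]
          exact Real.pow_rpow_inv_natCast (by positivity) (by omega)
  rw [le_div_iff₀ (Real.rpow_pos_of_pos hpos _)]
  refine le_trans ?_ hcov
  calc _ ≤ (n : ℝ) / (2 * (n + 1)) * (Q.trace / n) := by gcongr
    _ = _ := by field_simp

end IsConnectedLaplacian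

/-! ### From multigraphs to Laplacian matrices -/

section Multigraph

variable {α β : Type*} (G : Graph α β)

theorem adjacencyMatrix_apply (u v : G.vertexSet) :
    adjacencyMatrix G u v = (({e | G.IsLink e u v} : Set β).ncard : ℤ) :=
  rfl

theorem degree_eq_sum_adjacencyMatrix [Fintype G.vertexSet] (hfin : G.edgeSet.Finite)
    (u : G.vertexSet) : degree G u = ∑ v, adjacencyMatrix G u v := by
  -- Edges at `u` are partitioned by their other end.
  have hun : G.incidenceSet (u : α) = ⋃ v : G.vertexSet, {e | G.IsLink e u v} := by
    ext e
    simp only [Set.mem_iUnion]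
    exact ⟨fun ⟨y, hy⟩ => ⟨⟨y, hy.right_mem⟩, hy⟩, fun ⟨v, hv⟩ => ⟨v, hv⟩⟩
  rw [degree, hun, Set.ncard_iUnion_of_finite]
  · simp [finsum_eq_sum_of_fintype, adjacencyMatrix_apply]
  · exact fun v => hfin.subset fun e he => Graph.IsLink.edge_mem he
  · intro v w hvw
    refine Set.disjoint_left.2 fun e he he' => hvw (Subtype.ext ?_)
    exact Graph.IsLink.right_unique he he'

theorem isConnectedLaplacian_laplacianMatrix [DecidableEq α] [Fintype G.vertexSet]
    (hfin : G.edgeSet.Finite) [G.Loopless] (hconn : IsConnected G) :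
    IsConnectedLaplacian (laplacianMatrix G) where
  isSymm := by
    ext u v
    have h1 : adjacencyMatrix G v u = adjacencyMatrix G u v := by
      simp only [adjacencyMatrix_apply, Graph.isLink_comm]
    rcases eq_or_ne u v with rfl | huv
    · rfl
    · simp [laplacianMatrix, h1, huv, huv.symm]
  offDiag_nonpos u v huv := by
    simp [laplacianMatrix, huv, adjacencyMatrix_apply]
  sum_row u := by
    simp [laplacianMatrix, Finset.sum_sub_distrib, degree_eq_sum_adjacencyMatrix G hfin,
      Matrix.diagonal_apply]
  connected u v := by
    have step : ∀ a b : G.vertexSet, G.Adj (a : α) b → laplacianMatrix G a b < 0 := by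
      intro a b hab
      -- Looplessness puts the entry off the diagonal.
      have hne : a ≠ b := fun h => hab.ne (congrArg Subtype.val h)
      obtain ⟨e, he⟩ := hab
      have hf : ({e | G.IsLink e a b} : Set β).Finite :=
        hfin.subset fun e he => Graph.IsLink.edge_mem he
      have : 0 < ({e | G.IsLink e a b} : Set β).ncard := (Set.ncard_pos hf).2 ⟨e, he⟩
      simpa [laplacianMatrix, hne, adjacencyMatrix_apply] using this
    -- Paths run in `α`, so membership of the endpoint is quantified inside the induction.
    have aux : ∀ y, Relation.ReflTransGen G.Adj (u : α) y → ∀ hy : y ∈ G.vertexSet,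
        Relation.ReflTransGen (fun a b => laplacianMatrix G a b < 0) u ⟨y, hy⟩ := by
      intro y hy
      induction hy with
      | refl => exact fun _ => .refl
      | tail _ hadj ih => exact fun hy => (ih hadj.left_mem).tail (step ⟨_, hadj.left_mem⟩ _ hadj)
    exact aux v (hconn.2 u u.2 v v.2) v.2

end Multigraph

end LaplacianLattice

theorem mainTheorem6 {α β : Type*} [DecidableEq α] (G : Graph α β) [Fintype G.vertexSet]
    (n : ℕ) (hn : 1 ≤ n) (hcard : Fintype.card G.vertexSet = n + 1)
    (hfin : G.edgeSet.Finite) [G.Loopless]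
    (hconn : LaplacianLattice.IsConnected G) :
    (n : ℝ) / (2 * ((n : ℝ) + 1)) ≤
      LaplacianLattice.coveringDensity (LaplacianLattice.regularSimplex G.vertexSet)
        (LaplacianLattice.laplacianLattice G) :=
  (LaplacianLattice.isConnectedLaplacian_laplacianMatrix G hfin hconn).le_coveringDensity hn hcard
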